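/- A continuum is a nonempty compact connected metric space. For a continuum $X$ with metric $d$, let $2^X$ be the set of nonempty closed subsets of $X$ with the topology of the Hausdorff metric (equivalently, the Vietoris topology), and let $C(X)\subseteq 2^X$ be the subspace of connected members (the subcontinua of $X$). $X$ is decomposable if it is the union of two proper subcontinua. $X$ has the property of Kelley if whenever $x_n\to x$ in $X$ and $x\in A\in C(X)$, there are $A_n\in C(X)$ with $x_n\in A_n$ for all $n$ and $A_n\to A$. Let $\mathcal{NB}(\mathcal F_1(X))$ be the subspace of $2^X$ consisting of those nonempty closed sets $A\subsetneq X$ such that, for every $x\in X\setminus A$, the union of all subcontinua $L$ of $X$ with $x\in L\subseteq X\setminus A$ is dense in $X$. For $x\in X$ define $$\pi(x)=\begin{cases}\bigcap\{A\in\mathcal{NB}(\mathcal F_1(X)) : x\in A\}, & \text{if } x\in\bigcup\mathcal{NB}(\mathcal F_1(X)),\\ X, & \text{otherwise.}\end{cases}$$ Theorem. Let $X$ be a decomposable continuum with the property of Kelley such that $\mathcal{NB}(\mathcal F_1(X))$ is a continuum. Then $\pi(x)\in C(X)$ for every $x\in X$, and the map $\pi\colon X\to C(X)$ is continuous. -/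

import Mathlib

open TopologicalSpace Filter Topology

/-! For a compact Hausdorff space `X`, the hyperspace `2^X` of nonempty closed subsets is
`NonemptyCompacts X`, with the Vietoris topology (induced by the Hausdorff metric when `X` is a
compact metric space). -/

namespace Hyperspace

/-- A subset of a space is a continuum if it is compact, connected and nonempty. -/
def IsContinuum {Y : Type*} [TopologicalSpace Y] (S : Set Y) : Prop :=
  IsCompact S ∧ IsConnected S

/-- The hyperspace `C(X)` of subcontinua of `X`, as a subset of `2^X`. -/
def subcontinua (X : Type*) [TopologicalSpace X] : Set (NonemptyCompacts X) :=
  {A | IsConnected (A : Set X)}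

/-- `X` is the union of two proper subcontinua. -/
def IsDecomposable (X : Type*) [TopologicalSpace X] : Prop :=
  ∃ M ∈ subcontinua X, ∃ N ∈ subcontinua X,
    (M : Set X) ≠ Set.univ ∧ (N : Set X) ≠ Set.univ ∧ (M : Set X) ∪ (N : Set X) = Set.univ

/-- The property of Kelley. -/
def HasKelleyProperty (X : Type*) [TopologicalSpace X] : Prop :=
  ∀ (x : X) (u : ℕ → X), Tendsto u atTop (𝓝 x) →
    ∀ A ∈ subcontinua X, x ∈ A →
      ∃ K : ℕ → NonemptyCompacts X,
        (∀ n, K n ∈ subcontinua X ∧ u n ∈ K n) ∧ Tendsto K atTop (𝓝 A)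

/-- `kappa A B` is the union of all subcontinua of `X` that meet `B` and miss `A`. -/
def kappa {X : Type*} [TopologicalSpace X] (A B : Set X) : Set X :=
  ⋃ L ∈ {L ∈ subcontinua X | (B ∩ (L : Set X)).Nonempty ∧ (L : Set X) ⊆ Aᶜ}, (L : Set X)

/-- `A` blocks `B` (for disjoint nonempty closed sets `A`, `B`). -/
def Blocks {X : Type*} [TopologicalSpace X] (A B : Set X) : Prop :=
  closure (kappa A B) ≠ Set.univ

/-- The hyperspace of nonblockers of the singletons of `X`: the proper nonempty closed sets `A`
which do not block any singleton `{x}` with `x ∉ A`. (The whole space, for which the condition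
would be vacuous, is not a nonblocker.) -/
def nonblockers (X : Type*) [TopologicalSpace X] : Set (NonemptyCompacts X) :=
  {A | (A : Set X) ≠ Set.univ ∧ ∀ x : X, x ∉ A → ¬ Blocks (A : Set X) {x}}

open Classical in
/-- The underlying set of `π x`: the intersection of all nonblockers that contain `x` if there
is one, and the whole space otherwise. -/
noncomputable def piSet {X : Type*} [TopologicalSpace X] (x : X) : Set X :=
  if x ∈ ⋃ A ∈ nonblockers X, (A : Set X) then
    ⋂ A ∈ {A ∈ nonblockers X | x ∈ A}, (A : Set X)
  else Set.univ

theorem isClosed_piSet {X : Type*} [TopologicalSpace X] [T2Space X] (x : X) :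
    IsClosed (piSet x) := by
  unfold piSet
  split_ifs
  · exact isClosed_biInter fun A _ => A.isCompact.isClosed
  · exact isClosed_univ

theorem mem_piSet {X : Type*} [TopologicalSpace X] (x : X) : x ∈ piSet x := by
  unfold piSet
  split_ifs
  · exact Set.mem_iInter₂.2 fun A hA => hA.2
  · trivial

/-- The function `π`, with values in `2^X`. -/
noncomputable def pi {X : Type*} [TopologicalSpace X] [T2Space X] [CompactSpace X] (x : X) :
    NonemptyCompacts X where
  carrier := piSet x
  isCompact' := (isClosed_piSet x).isCompact
  nonempty' := ⟨x, mem_piSet x⟩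

end Hyperspace

/-!
A nonblocker is a proper nonempty closed set `A` such that every point outside `A` can be joined
to a dense set of points by continua missing `A`. Nonblockers are closed under nonempty
intersections, so for `x` in a nonblocker `piSet x` is the smallest nonblocker containing `x`.
By boundary bumping (`exists_isContinuum_not_subset`) a relatively clopen part of a nonblocker is
again a nonblocker (`mem_nonblockers_of_union`). Hence `piSet x` is connected, which is the first
half of the claim and uses only that `X` is a continuum.

The property of Kelley makes `kappa F W` open whenever `W` is a continuum with interior points
that misses the closed set `F` (`isOpen_kappa`). If `kappa F W` is moreover dense, its complement
is a nonblocker. A minimality argument then shows that every proper subcontinuum with interior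
points is missed by some nonblocker (`exists_mem_nonblockers_disjoint`). Write `X = M ∪ N` with
proper subcontinua `M` and `N`, and let `U` be the union of all nonblockers, a continuum because
the nonblockers form one. No nonblocker misses `U`, so a continuum with interior points that
contains `U` is all of `X`. This applies to `M ∪ U` and `N ∪ U`, and then to `U` itself: every
point lies in a nonblocker (`biUnion_nonblockers_eq_univ`).

It follows that `kappa {p} W` is dense for every `p ∉ W`: a nonblocker through `p` has empty
interior and cannot contain an open set that `p` separates from `W`. Consequently `piSet p` misses
every continuum `W` with interior points that does not contain `p` (`disjoint_piSet`).

Such a `W` exists for every point `p` (`exists_isContinuum_notMem`). If there were none, then all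
finite subsets of `Mᶜ` would lie in nonblockers, since a finite set `F` that separates `M` from an
open set leaves a component with interior points in the complement of `kappa F M`. Compactness of
the nonblockers would give a nonblocker containing the nonempty open set `Mᶜ`.

Continuity is now proved in two halves. Compactness of the set of nonblockers gives lower
semicontinuity (`isOpen_piSet_inter_nonempty`). For upper semicontinuity
(`isOpen_piSet_subset`), each point outside `piSet x` is interior to a continuum `L` missing
`piSet x`; for `x'` near `x` also `x' ∉ L`, so `piSet x'` misses `L`, and finitely many such `L`
cover a given compact set outside `piSet x`.
-/

namespace Hyperspace

open Set

/-! ### Boundary bumping -/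

section Bumping

variable {X : Type*} [TopologicalSpace X]

/-- In a compact Hausdorff set, the quasi-component of a point is its component: a component
contained in an open set `V` is contained in a relatively clopen subset of `V`. -/
theorem exists_isClosed_of_connectedComponentIn_subset [T2Space X] {K V : Set X}
    (hK : IsCompact K) {y : X} (hy : y ∈ K) (hV : IsOpen V)
    (h : connectedComponentIn K y ⊆ V) :
    ∃ Q ⊆ K, y ∈ Q ∧ Q ⊆ V ∧ IsClosed Q ∧ IsClosed (K \ Q) := by
  have : CompactSpace K := isCompact_iff_compactSpace.1 hK
  rw [connectedComponentIn_eq_image hy, image_subset_iff, connectedComponent_eq_iInter_isClopen]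
    at h
  have hdir : Directed (· ⊇ ·)
      fun s : {s : Set K // IsClopen s ∧ (⟨y, hy⟩ : K) ∈ s} => (s : Set K) := fun s t =>
    ⟨⟨s ∩ t, s.2.1.inter t.2.1, s.2.2, t.2.2⟩, inter_subset_left, inter_subset_right⟩
  have : Nonempty {s : Set K // IsClopen s ∧ (⟨y, hy⟩ : K) ∈ s} := ⟨⟨univ, isClopen_univ, trivial⟩⟩
  obtain ⟨⟨s, hs, hys⟩, hsV⟩ := exists_subset_nhds_of_compactSpace hdir (fun s => s.2.1.isClosed)
    (fun z hz => (hV.preimage continuous_subtype_val).mem_nhds (h hz))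
  refine ⟨Subtype.val '' s, Subtype.coe_image_subset _ _, ⟨_, hys, rfl⟩, image_subset_iff.2 hsV,
    hK.isClosed.isClosedEmbedding_subtypeVal.isClosedMap _ hs.isClosed, ?_⟩
  have : K \ Subtype.val '' s = Subtype.val '' sᶜ := by
    rw [image_compl_eq_range_sdiff_image Subtype.val_injective, Subtype.range_coe]
  rw [this]
  exact hK.isClosed.isClosedEmbedding_subtypeVal.isClosedMap _ hs.compl.isClosed

theorem isClosed_connectedComponentIn {K : Set X} (hK : IsClosed K) (y : X) :
    IsClosed (connectedComponentIn K y) := by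
  by_cases hy : y ∈ K
  · exact isClosed_of_closure_subset
      (isPreconnected_connectedComponentIn.closure.subset_connectedComponentIn
        (subset_closure (mem_connectedComponentIn hy))
        (closure_minimal (connectedComponentIn_subset _ _) hK))
  · rw [connectedComponentIn_eq_empty hy]
    exact isClosed_empty

/-- Boundary bumping: in a continuum, every point of a closed set `Q` lies in a continuum that
leaves `Q` but stays in a given proper open neighbourhood of `Q`. -/
theorem exists_isContinuum_not_subset [CompactSpace X] [T2Space X] [PreconnectedSpace X]
    {Q V : Set X} (hQ : IsClosed Q) (hV : IsOpen V) (hQV : Q ⊆ V) (hV' : V ≠ univ) {y : X}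
    (hy : y ∈ Q) : ∃ T, IsContinuum T ∧ y ∈ T ∧ T ⊆ V ∧ ¬ T ⊆ Q := by
  obtain ⟨V₁, hV₁, hQV₁, hcl⟩ := normal_exists_closure_subset hQ hV hQV
  have hy₁ : y ∈ closure V₁ := subset_closure (hQV₁ hy)
  have hc : IsClosed (connectedComponentIn (closure V₁) y) :=
    isClosed_connectedComponentIn isClosed_closure y
  refine ⟨connectedComponentIn (closure V₁) y, ⟨hc.isCompact,
    isConnected_connectedComponentIn_iff.2 hy₁⟩, mem_connectedComponentIn hy₁,
    (connectedComponentIn_subset _ _).trans hcl, fun hT => hV' ?_⟩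
  obtain ⟨S, hS, hyS, hSV, hSc, hSc'⟩ := exists_isClosed_of_connectedComponentIn_subset
    isClosed_closure.isCompact hy₁ hV₁ (hT.trans hQV₁)
  have hS_eq : S = V₁ ∩ (closure V₁ \ S)ᶜ := by
    ext z
    constructor
    · exact fun hz => ⟨hSV hz, fun h => h.2 hz⟩
    · exact fun ⟨hz, hz'⟩ => by_contra fun h => hz' ⟨subset_closure hz, h⟩
  have hSo : IsOpen S := by
    rw [hS_eq]
    exact hV₁.inter hSc'.isOpen_compl
  have : S = univ := IsClopen.eq_univ ⟨hSc, hSo⟩ ⟨y, hyS⟩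
  exact univ_subset_iff.1 (this ▸ hS.trans hcl)

theorem IsContinuum.isClosed [T2Space X] {L : Set X} (hL : IsContinuum L) : IsClosed L :=
  hL.1.isClosed

theorem IsContinuum.union {L M : Set X} (hL : IsContinuum L) (hM : IsContinuum M)
    (h : (L ∩ M).Nonempty) : IsContinuum (L ∪ M) :=
  ⟨hL.1.union hM.1, hL.2.union h hM.2⟩

end Bumping

/-! ### The sets `kappa A B` -/

section Kappa

variable {X : Type*} [TopologicalSpace X]

theorem mem_kappa {A B : Set X} {y : X} :
    y ∈ kappa A B ↔ ∃ L, IsContinuum L ∧ (B ∩ L).Nonempty ∧ Disjoint L A ∧ y ∈ L := by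
  simp only [kappa, mem_iUnion, exists_prop]
  constructor
  · rintro ⟨L, ⟨hL, hB, hA⟩, hy⟩
    exact ⟨L, ⟨L.isCompact, hL⟩, hB, disjoint_left.2 hA, hy⟩
  · rintro ⟨L, hL, hB, hA, hy⟩
    exact ⟨⟨⟨L, hL.1⟩, hL.2.nonempty⟩, ⟨hL.2, hB, disjoint_left.1 hA⟩, hy⟩

theorem kappa_anti {A A' : Set X} (h : A ⊆ A') (B : Set X) : kappa A' B ⊆ kappa A B := by
  intro y hy
  obtain ⟨L, hL, hB, hA, hyL⟩ := mem_kappa.1 hy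
  exact mem_kappa.2 ⟨L, hL, hB, hA.mono_right h, hyL⟩

theorem disjoint_kappa (A B : Set X) : Disjoint (kappa A B) A := by
  rw [disjoint_left]
  intro y hy
  obtain ⟨L, hL, hB, hA, hyL⟩ := mem_kappa.1 hy
  exact disjoint_left.1 hA hyL

theorem subset_kappa {A W : Set X} (hW : IsContinuum W) (h : Disjoint W A) : W ⊆ kappa A W :=
  fun y hy => mem_kappa.2 ⟨W, hW, by rw [inter_self]; exact hW.2.nonempty, h, hy⟩

/-- A continuum that misses `A` and meets `kappa A W` can be continued to `W`. -/
theorem IsContinuum.subset_kappa {A W L : Set X} (hL : IsContinuum L) (hA : Disjoint L A)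
    (h : (kappa A W ∩ L).Nonempty) : L ⊆ kappa A W := by
  obtain ⟨z, hz, hzL⟩ := h
  obtain ⟨L', hL', hW, hA', hzL'⟩ := mem_kappa.1 hz
  exact fun y hy => mem_kappa.2 ⟨L' ∪ L, hL'.union hL ⟨z, hzL', hzL⟩,
    hW.mono (inter_subset_inter_right _ subset_union_left), hA'.union_left hA, Or.inr hy⟩

theorem isConnected_kappa {A W : Set X} (hW : IsContinuum W) (h : Disjoint W A) :
    IsConnected (kappa A W) := by
  obtain ⟨w, hw⟩ := hW.2.nonempty
  refine ⟨⟨w, Hyperspace.subset_kappa hW h hw⟩, isPreconnected_of_forall w fun y hy => ?_⟩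
  obtain ⟨L, hL, hWL, hA, hyL⟩ := mem_kappa.1 hy
  have hWL' := hW.union hL hWL
  exact ⟨W ∪ L, hWL'.subset_kappa (h.union_left hA)
    ⟨w, Hyperspace.subset_kappa hW h hw, Or.inl hw⟩, Or.inl hw, Or.inr hyL, hWL'.2.isPreconnected⟩

/-- Any two points of `kappa F W` lie in a continuum contained in `kappa F W`, formed from two
continua that meet `W` and `W` itself. -/
theorem kappa_kappa_compl {F W : Set X} (hF : Disjoint W F) (hW : IsContinuum W) {y : X}
    (hy : y ∈ kappa F W) : kappa F W ⊆ kappa (kappa F W)ᶜ {y} := by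
  intro z hz
  obtain ⟨L, hL, hWL, hA, hyL⟩ := mem_kappa.1 hy
  obtain ⟨L', hL', hWL', hA', hzL'⟩ := mem_kappa.1 hz
  have h₁ := hL.subset_kappa (W := W) hA (hWL.mono
    (inter_subset_inter_left _ (Hyperspace.subset_kappa hW hF)))
  have h₂ := hL'.subset_kappa (W := W) hA' (hWL'.mono
    (inter_subset_inter_left _ (Hyperspace.subset_kappa hW hF)))
  refine mem_kappa.2 ⟨(W ∪ L) ∪ L', (hW.union hL hWL).union hL'
    (hWL'.mono (inter_subset_inter_left _ subset_union_left)), ⟨y, rfl, Or.inl (Or.inr hyL)⟩, ?_,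
    Or.inr hzL'⟩
  exact disjoint_compl_right_iff_subset.2
    (union_subset (union_subset (Hyperspace.subset_kappa hW hF) h₁) h₂)

/-- The property of Kelley moves a continuum joining `y` to the interior of `W` to nearby continua
through the points near `y`. Hence `kappa F W` is open when `W` has interior points. -/
theorem isOpen_kappa {X : Type*} [MetricSpace X] (hK : HasKelleyProperty X) {F W : Set X}
    (hF : IsClosed F) (hW : IsContinuum W) (hWi : (interior W).Nonempty) (hWF : Disjoint W F) :
    IsOpen (kappa F W) := by
  rw [← isClosed_compl_iff]
  refine IsSeqClosed.isClosed fun u y hu huy hy => ?_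
  obtain ⟨L, hL, hWL, hA, hyL⟩ := mem_kappa.1 hy
  have hWL' := hW.union hL hWL
  obtain ⟨K, hK, hlim⟩ := hK y u huy ⟨⟨W ∪ L, hWL'.1⟩, hWL'.2.nonempty⟩ hWL'.2 (Or.inr hyL)
  obtain ⟨w, hw⟩ := hWi
  have h₁ := hlim.eventually ((NonemptyCompacts.isOpen_inter_nonempty_of_isOpen
    isOpen_interior).mem_nhds (show ((W ∪ L) ∩ interior W).Nonempty from
      ⟨w, Or.inl (interior_subset hw), hw⟩))
  have h₂ := hlim.eventually ((NonemptyCompacts.isOpen_subsets_of_isOpen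
    hF.isOpen_compl).mem_nhds (show W ∪ L ⊆ Fᶜ from
      disjoint_left.1 (hWF.union_left hA)))
  obtain ⟨n, ⟨z, hz, hz'⟩, hn⟩ := (h₁.and h₂).exists
  exact hu n (mem_kappa.2 ⟨K n, ⟨(K n).isCompact, (hK n).1⟩, ⟨z, interior_subset hz', hz⟩,
    disjoint_left.2 hn, (hK n).2⟩)

end Kappa

/-! ### Nonblockers in an arbitrary continuum -/

section Nonblockers

variable {X : Type*} [TopologicalSpace X]

theorem mem_nonblockers {A : NonemptyCompacts X} :
    A ∈ nonblockers X ↔ (A : Set X) ≠ univ ∧ ∀ x ∉ (A : Set X), Dense (kappa (A : Set X) {x}) := by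
  simp only [nonblockers, Blocks, mem_ofPred_eq, not_not, dense_iff_closure_eq, SetLike.mem_coe]

/-- Intersections of nonblockers are nonblockers: removing fewer points enlarges `kappa`, and a
point outside the intersection lies outside one of the members. -/
theorem mem_nonblockers_of_eq_sInter {S : Set (NonemptyCompacts X)} (hS : S ⊆ nonblockers X)
    (hS' : S.Nonempty) {B : NonemptyCompacts X} (hB : (B : Set X) = ⋂ A ∈ S, (A : Set X)) :
    B ∈ nonblockers X := by
  have hsub : ∀ A ∈ S, (B : Set X) ⊆ A := fun A hA => hB ▸ biInter_subset_of_mem hA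
  refine mem_nonblockers.2 ⟨fun h => ?_, fun x hx => ?_⟩
  · obtain ⟨A, hA⟩ := hS'
    exact (mem_nonblockers.1 (hS hA)).1 (univ_subset_iff.1 (h ▸ hsub A hA))
  · rw [hB, mem_iInter₂] at hx
    push Not at hx
    obtain ⟨A, hA, hxA⟩ := hx
    exact ((mem_nonblockers.1 (hS hA)).2 x hxA).mono (kappa_anti (hsub A hA) _)

/-- The dense sets `kappa A {x}` are disjoint from `A`. -/
theorem interior_eq_empty_of_mem_nonblockers {A : NonemptyCompacts X} (hA : A ∈ nonblockers X) :
    interior (A : Set X) = ∅ := by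
  obtain ⟨hA, hA'⟩ := mem_nonblockers.1 hA
  obtain ⟨x, hx⟩ := (ne_univ_iff_exists_notMem _).1 hA
  exact interior_eq_empty_iff_dense_compl.2
    ((hA' x hx).mono (disjoint_left.1 (disjoint_kappa _ _)))

/-- A relatively clopen part `B` of a nonblocker is a nonblocker: by boundary bumping, a point of
the complementary part `P` lies in a continuum that misses `B` and leaves `P`. -/
theorem mem_nonblockers_of_union [CompactSpace X] [T2Space X] [PreconnectedSpace X]
    {A B : NonemptyCompacts X} (hA : A ∈ nonblockers X) {P : Set X} (hP : IsClosed P)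
    (hPB : Disjoint P B) (hAPB : (A : Set X) = P ∪ B) : B ∈ nonblockers X := by
  obtain ⟨hA, hA'⟩ := mem_nonblockers.1 hA
  have hBA : (B : Set X) ⊆ A := hAPB ▸ subset_union_right
  refine mem_nonblockers.2 ⟨fun h => hA (univ_subset_iff.1 (h ▸ hBA)), fun x hx => ?_⟩
  by_cases hxA : x ∈ (A : Set X)
  · have hxP : x ∈ P := (hAPB ▸ hxA : x ∈ P ∪ (B : Set X)).resolve_right hx
    obtain ⟨T, hT, hxT, hTB, hTP⟩ := exists_isContinuum_not_subset hP
      B.isCompact.isClosed.isOpen_compl (disjoint_left.1 hPB)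
      (by simpa using B.nonempty.ne_empty) hxP
    obtain ⟨y, hyT, hyP⟩ := not_subset.1 hTP
    have hyA : y ∉ (A : Set X) := hAPB ▸ fun h => h.elim hyP (hTB hyT)
    refine ((hA' y hyA).mono (kappa_anti hBA _)).mono fun z hz => ?_
    obtain ⟨L, hL, ⟨y', rfl, hyL⟩, hLB, hzL⟩ := mem_kappa.1 hz
    exact mem_kappa.2 ⟨T ∪ L, hT.union hL ⟨y', hyT, hyL⟩, ⟨x, rfl, Or.inl hxT⟩,
      (disjoint_left.2 hTB).union_left hLB, Or.inr hzL⟩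
  · exact (hA' x hxA).mono (kappa_anti hBA _)

theorem piSet_subset {x : X} {A : NonemptyCompacts X} (hA : A ∈ nonblockers X)
    (hx : x ∈ (A : Set X)) : piSet x ⊆ A := by
  rw [piSet, if_pos (mem_biUnion hA hx)]
  exact biInter_subset_of_mem (show A ∈ {A ∈ nonblockers X | x ∈ A} from ⟨hA, hx⟩)

variable [T2Space X] [CompactSpace X]

theorem coe_pi (x : X) : (pi x : Set X) = piSet x := rfl

theorem pi_mem_nonblockers {x : X} (hx : x ∈ ⋃ A ∈ nonblockers X, (A : Set X)) :
    pi x ∈ nonblockers X := by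
  refine mem_nonblockers_of_eq_sInter (S := {A ∈ nonblockers X | x ∈ A}) (fun A hA => hA.1) ?_ ?_
  · obtain ⟨A, hA, hxA⟩ := mem_iUnion₂.1 hx
    exact ⟨A, hA, hxA⟩
  · rw [coe_pi, piSet, if_pos hx]

/-- The smallest nonblocker containing `x` is connected, as it has no smaller clopen part. -/
theorem pi_mem_subcontinua [ConnectedSpace X] (x : X) : pi x ∈ subcontinua X := by
  by_cases hx : x ∈ ⋃ A ∈ nonblockers X, (A : Set X)
  swap
  · change IsConnected (piSet x)
    rw [piSet, if_neg hx]
    exact isConnected_univ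
  refine ⟨⟨x, mem_piSet x⟩, isPreconnected_closed_iff.2 fun t t' ht ht' hcov hne hne' => ?_⟩
  by_contra hdisj
  rw [not_nonempty_iff_eq_empty] at hdisj
  change piSet x ∩ (t ∩ t') = ∅ at hdisj
  change piSet x ⊆ t ∪ t' at hcov
  wlog hxt : x ∈ t generalizing t t'
  · exact this t' t ht' ht hne' hne (by rwa [inter_comm t']) (by rwa [union_comm])
      ((hcov (mem_piSet x)).resolve_left hxt)
  have hcl := isClosed_piSet x
  let B : NonemptyCompacts X := ⟨⟨piSet x ∩ t, (hcl.inter ht).isCompact⟩, hne⟩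
  have hB : B ∈ nonblockers X := by
    refine mem_nonblockers_of_union (pi_mem_nonblockers hx) (hcl.inter ht') ?_ ?_
    · exact disjoint_left.2 fun y hy hy' => hdisj.subset ⟨hy.1, hy'.2, hy.2⟩
    · change piSet x = piSet x ∩ t' ∪ piSet x ∩ t
      rw [← inter_union_distrib_left, union_comm, inter_eq_left.2 hcov]
  obtain ⟨y, hy, hyt'⟩ := hne'
  exact hdisj.subset ⟨hy, (piSet_subset hB ⟨mem_piSet x, hxt⟩ hy).2, hyt'⟩

/-- The union of a continuum of nonblockers is a continuum. -/
theorem isContinuum_biUnion_nonblockers [ConnectedSpace X] (hNB : IsContinuum (nonblockers X)) :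
    IsContinuum (⋃ A ∈ nonblockers X, (A : Set X)) := by
  refine ⟨NonemptyCompacts.isCompact_biUnion_coe_of_isCompact hNB.1, ?_⟩
  obtain ⟨A, hA⟩ := hNB.2.nonempty
  obtain ⟨x, hx⟩ := A.nonempty
  have hxU : x ∈ ⋃ A ∈ nonblockers X, (A : Set X) := mem_biUnion hA hx
  let := TopologicalSpace.vietoris X
  exact ⟨⟨x, hxU⟩, vietoris.isPreconnected_biUnion hNB.2.isPreconnected
    NonemptyCompacts.continuous_coe.continuousOn
    ⟨pi x, pi_mem_nonblockers hxU, (pi_mem_subcontinua x).isPreconnected⟩⟩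

end Nonblockers

/-! ### Nonblockers in a continuum with the property of Kelley -/

section Kelley

variable {X : Type*} [MetricSpace X]

/-- A nonblocker through `p` leaves no room for an open set that `p` separates from `W`. -/
theorem dense_kappa_singleton (hK : HasKelleyProperty X) {W : Set X}
    (hW : IsContinuum W) (hWi : (interior W).Nonempty) {p : X} (hpW : p ∉ W)
    (hp : p ∈ ⋃ A ∈ nonblockers X, (A : Set X)) : Dense (kappa {p} W) := by
  have hpW' : Disjoint W {p} := disjoint_singleton_right.2 hpW
  obtain ⟨A, hA, hpA⟩ := mem_iUnion₂.1 hp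
  have hAi := interior_eq_empty_of_mem_nonblockers hA
  by_contra hd
  have hne : (closure (kappa {p} W))ᶜ.Nonempty :=
    nonempty_compl.2 (mt dense_iff_closure_eq.2 hd)
  obtain ⟨y, hy, hyA⟩ : ∃ y ∈ (closure (kappa {p} W))ᶜ, y ∉ (A : Set X) := by
    by_contra! h
    exact hne.ne_empty (subset_empty_iff.1
      (hAi ▸ interior_maximal h isClosed_closure.isOpen_compl))
  obtain ⟨z, hz, hz'⟩ := ((mem_nonblockers.1 hA).2 y hyA).inter_open_nonempty _
    (isOpen_kappa hK isClosed_singleton hW hWi hpW')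
    (hW.2.nonempty.mono (subset_kappa hW hpW'))
  obtain ⟨L, hL, ⟨y', rfl, hyL⟩, hLA, hzL⟩ := mem_kappa.1 hz'
  exact hy (subset_closure (hL.subset_kappa
    (hLA.mono_right (singleton_subset_iff.2 hpA)) ⟨z, hz, hzL⟩ hyL))

theorem nonempty_interior_of_union_eq_univ {M N : Set X} (hN : IsClosed N) (hNu : N ≠ univ)
    (hMN : M ∪ N = univ) : (interior M).Nonempty :=
  (nonempty_compl.2 hNu).mono (interior_maximal
    (fun x hx => ((hMN.symm.subset (mem_univ x) : x ∈ M ∪ N)).resolve_right hx) hN.isOpen_compl)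

variable [CompactSpace X]

/-- The complement of a dense `kappa F W` is a nonblocker, because any two points of `kappa F W`
lie in a continuum contained in it. -/
theorem exists_mem_nonblockers_of_dense_kappa (hK : HasKelleyProperty X) {F W : Set X}
    (hF : IsClosed F) (hFne : F.Nonempty) (hW : IsContinuum W) (hWi : (interior W).Nonempty)
    (hWF : Disjoint W F) (hd : Dense (kappa F W)) :
    ∃ A ∈ nonblockers X, (A : Set X) = (kappa F W)ᶜ := by
  have hsub : F ⊆ (kappa F W)ᶜ := disjoint_right.1 (disjoint_kappa F W)
  refine ⟨⟨⟨(kappa F W)ᶜ, (isOpen_kappa hK hF hW hWi hWF).isClosed_compl.isCompact⟩,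
    hFne.mono hsub⟩, mem_nonblockers.2 ⟨fun h => ?_, fun x hx => ?_⟩, rfl⟩
  · obtain ⟨w, hw⟩ := hW.2.nonempty
    exact (h.symm.subset (mem_univ w) : w ∈ (kappa F W)ᶜ) (subset_kappa hW hWF hw)
  · exact hd.mono (kappa_kappa_compl hWF hW (not_notMem.1 hx))

/-- Every proper subcontinuum `W` with interior points is missed by a nonblocker. It is
found as a minimal closed set `A` disjoint from `W` with complement `kappa A W`. -/
theorem exists_mem_nonblockers_disjoint [ConnectedSpace X] (hK : HasKelleyProperty X) {W : Set X}
    (hW : IsContinuum W) (hWi : (interior W).Nonempty) (hWu : W ≠ univ) :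
    ∃ A ∈ nonblockers X, Disjoint (A : Set X) W := by
  let S : Set (Set X) := {A | IsClosed A ∧ A.Nonempty ∧ Disjoint W A ∧ Aᶜ ⊆ kappa A W}
  have hS : ∀ p ∉ W, (kappa {p} W)ᶜ ∈ S := fun p hp => by
    have hpW : Disjoint W {p} := disjoint_singleton_right.2 hp
    refine ⟨(isOpen_kappa hK isClosed_singleton hW hWi hpW).isClosed_compl,
      ⟨p, disjoint_right.1 (disjoint_kappa {p} W) rfl⟩,
      disjoint_compl_right_iff_subset.2 (subset_kappa hW hpW), fun z hz => ?_⟩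
    rw [compl_compl] at hz
    obtain ⟨L, hL, hWL, hLp, hzL⟩ := mem_kappa.1 hz
    exact mem_kappa.2 ⟨L, hL, hWL, disjoint_compl_right_iff_subset.2 (hL.subset_kappa hLp
      (hWL.mono (inter_subset_inter_left _ (subset_kappa hW hpW)))), hzL⟩
  obtain ⟨p₀, hp₀⟩ := (ne_univ_iff_exists_notMem W).1 hWu
  obtain ⟨A, -, hA⟩ := zorn_superset_nonempty S (fun c hcS hc hcne => by
    have : Nonempty c := hcne.to_subtype
    refine ⟨⋂₀ c, ⟨isClosed_sInter fun s hs => (hcS hs).1, ?_, ?_, ?_⟩,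
      fun s hs => sInter_subset_of_mem hs⟩
    · exact IsCompact.nonempty_sInter_of_directed_nonempty_isCompact_isClosed
        (fun s hs t ht => (hc.total hs ht).elim (fun h => ⟨s, hs, Subset.rfl, h⟩)
          fun h => ⟨t, ht, h, Subset.rfl⟩) (fun s hs => (hcS hs).2.1) (fun s hs => (hcS hs).1.isCompact)
        (fun s hs => (hcS hs).1)
    · obtain ⟨s, hs⟩ := hcne
      exact (hcS hs).2.2.1.mono_right (sInter_subset_of_mem hs)
    · rw [compl_sInter]
      rintro z ⟨_, ⟨s, hs, rfl⟩, hz⟩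
      exact kappa_anti (sInter_subset_of_mem hs) _ ((hcS hs).2.2.2 hz)) _ (hS p₀ hp₀)
  obtain ⟨hAc, hAne, hWA, hAk⟩ := hA.prop
  have hAeq : (kappa A W)ᶜ = A := Subset.antisymm (compl_subset_comm.1 hAk)
    (disjoint_right.1 (disjoint_kappa A W))
  have hd : Dense (kappa A W) := by
    -- Otherwise `x ∈ A` lies off the continuum `closure (kappa A W)`. Minimality gives
    -- `kappa {x} W = kappa A W`, so this set is closed as well as open.
    by_contra hd
    have hkc := isConnected_kappa hW hWA
    obtain ⟨x, hx⟩ := (ne_univ_iff_exists_notMem _).1 (mt dense_iff_closure_eq.2 hd)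
    have hxA : x ∈ A := by
      rw [← hAeq]
      exact fun h => hx (subset_closure h)
    have hclk : closure (kappa A W) ⊆ kappa {x} W :=
      IsContinuum.subset_kappa ⟨isClosed_closure.isCompact, hkc.closure⟩
        (disjoint_singleton_right.2 hx) (by
          obtain ⟨w, hw⟩ := hW.2.nonempty
          exact ⟨w, subset_kappa hW (hWA.mono_right (singleton_subset_iff.2 hxA)) hw,
            subset_closure (subset_kappa hW hWA hw)⟩)
    have hle : A ⊆ (kappa {x} W)ᶜ := hA.le_of_le (hS x (disjoint_right.1 hWA hxA)) <| by
      rw [← hAeq]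
      exact compl_subset_compl.2 (subset_closure.trans hclk)
    have hcl : IsClosed (kappa A W) := by
      refine isClosed_of_closure_subset fun z hz => ?_
      by_contra h
      exact hle (hAeq.subset h) (hclk hz)
    have := IsClopen.eq_univ ⟨hcl, isOpen_kappa hK hAc hW hWi hWA⟩ hkc.nonempty
    exact hd (this ▸ dense_univ)
  obtain ⟨B, hB, hBA⟩ := exists_mem_nonblockers_of_dense_kappa hK hAc hAne hW hWi hWA hd
  exact ⟨B, hB, by rw [hBA, hAeq]; exact hWA.symm⟩

/-- The complement of `kappa {p} W` is a nonblocker containing `p`, so it contains `piSet p`. -/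
theorem disjoint_piSet (hK : HasKelleyProperty X) {W : Set X}
    (hW : IsContinuum W) (hWi : (interior W).Nonempty) {p : X} (hpW : p ∉ W)
    (hp : p ∈ ⋃ A ∈ nonblockers X, (A : Set X)) : Disjoint (piSet p) W := by
  have hpW' : Disjoint W {p} := disjoint_singleton_right.2 hpW
  obtain ⟨A, hA, hAk⟩ := exists_mem_nonblockers_of_dense_kappa hK isClosed_singleton
    (singleton_nonempty p) hW hWi hpW' (dense_kappa_singleton hK hW hWi hpW hp)
  have hpA : p ∈ (A : Set X) := hAk.symm.subset (disjoint_right.1 (disjoint_kappa {p} W) rfl)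
  have h := hAk ▸ piSet_subset hA hpA
  exact disjoint_left.2 fun z hz hzW => h hz (subset_kappa hW hpW' hzW)

/-- The nonblockers cover `X`. The union `U` of the nonblockers is a continuum that no nonblocker
misses, and neither do nonblockers miss `M ∪ U` or `N ∪ U`; so these are not proper, and then
`U` has interior points. -/
theorem biUnion_nonblockers_eq_univ [ConnectedSpace X] (hdec : IsDecomposable X)
    (hK : HasKelleyProperty X) (hNB : IsContinuum (nonblockers X)) :
    (⋃ A ∈ nonblockers X, (A : Set X)) = univ := by
  set U := ⋃ A ∈ nonblockers X, (A : Set X) with hU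
  have hUc : IsContinuum U := isContinuum_biUnion_nonblockers hNB
  have key : ∀ W : Set X, IsContinuum W → (interior W).Nonempty → U ⊆ W → W = univ := by
    intro W hW hWi hUW
    by_contra hWu
    obtain ⟨A, hA, hAW⟩ := exists_mem_nonblockers_disjoint hK hW hWi hWu
    obtain ⟨a, ha⟩ := A.nonempty
    exact disjoint_left.1 hAW ha (hUW (mem_biUnion hA ha))
  have step : ∀ M N : NonemptyCompacts X, M ∈ subcontinua X → N ∈ subcontinua X →
      (M : Set X) ≠ univ → (N : Set X) ≠ univ → (M : Set X) ∪ N = univ →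
      (M : Set X) ∪ U = univ := by
    intro M N hM hN hMu hNu hMN
    have hMi := nonempty_interior_of_union_eq_univ N.isCompact.isClosed hNu hMN
    have hNi := nonempty_interior_of_union_eq_univ M.isCompact.isClosed hMu
      ((union_comm _ _).trans hMN)
    obtain ⟨A, hA, hAN⟩ := exists_mem_nonblockers_disjoint hK ⟨N.isCompact, hN⟩ hNi hNu
    obtain ⟨a, ha⟩ := A.nonempty
    have haM : a ∈ (M : Set X) :=
      (hMN.symm.subset (mem_univ a) : a ∈ (M : Set X) ∪ N).resolve_right (disjoint_left.1 hAN ha)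
    exact key _ (IsContinuum.union ⟨M.isCompact, hM⟩ hUc ⟨a, haM, mem_biUnion hA ha⟩)
      (hMi.mono (interior_mono subset_union_left)) subset_union_right
  obtain ⟨M, hM, N, hN, hMu, hNu, hMN⟩ := hdec
  exact key U hUc (nonempty_interior_of_union_eq_univ M.isCompact.isClosed hMu
    ((union_comm _ _).trans (step M N hM hN hMu hNu hMN))) Subset.rfl

/-- If the finite set `F` separates `M` from an open set, then a component of the complement of
`kappa F M` has interior points: each of the components contains a point of `F`. -/
theorem exists_isContinuum_of_not_dense_kappa [ConnectedSpace X] (hK : HasKelleyProperty X)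
    {M : Set X} (hM : IsContinuum M) (hMi : (interior M).Nonempty) {F : Set X} (hF : F.Finite)
    (hFne : F.Nonempty) (hMF : Disjoint M F) (hd : ¬ Dense (kappa F M)) :
    ∃ W, IsContinuum W ∧ (interior W).Nonempty ∧ Disjoint W (kappa F M) := by
  set K := (kappa F M)ᶜ with hKdef
  have hKc : IsClosed K := (isOpen_kappa hK hF.isClosed hM hMi hMF).isClosed_compl
  have hFK : F ⊆ K := disjoint_right.1 (disjoint_kappa F M)
  have hcov : K ⊆ ⋃ f ∈ F, connectedComponentIn K f := by
    intro y hy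
    by_contra hyF
    have hcF : connectedComponentIn K y ⊆ Fᶜ := fun f hf hfF => hyF <| mem_biUnion hfF <| by
      rw [← connectedComponentIn_eq hf]
      exact mem_connectedComponentIn hy
    obtain ⟨Q, hQK, hyQ, hQF, hQc, hQc'⟩ := exists_isClosed_of_connectedComponentIn_subset
      hKc.isCompact hy hF.isClosed.isOpen_compl hcF
    obtain ⟨T, hT, hyT, hTV, hTQ⟩ := exists_isContinuum_not_subset hQc
      (V := (F ∪ K \ Q)ᶜ) (hF.isClosed.union hQc').isOpen_compl
      (fun z hz h => h.elim (hQF hz) fun h => h.2 hz)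
      (fun h => by
        obtain ⟨f, hf⟩ := hFne
        exact (h.symm.subset (mem_univ f) : f ∈ (F ∪ K \ Q)ᶜ) (Or.inl hf)) hyQ
    obtain ⟨z, hzT, hzQ⟩ := not_subset.1 hTQ
    have hzK : z ∈ kappa F M := by
      by_contra h
      exact hTV hzT (Or.inr ⟨h, hzQ⟩)
    exact hy (hT.subset_kappa (disjoint_left.2 fun z hz h => hTV hz (Or.inl h))
      ⟨z, hzK, hzT⟩ hyT)
  have hcc : ∀ f ∈ F, IsContinuum (connectedComponentIn K f) := fun f hf =>
    ⟨(isClosed_connectedComponentIn hKc f).isCompact, isConnected_connectedComponentIn_iff.2 (hFK hf)⟩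
  have hex : ∃ f ∈ F, (interior (connectedComponentIn K f)).Nonempty := by
    by_contra! h
    refine hd ((dense_biInter_of_isOpen
      (fun f _ => (isClosed_connectedComponentIn hKc f).isOpen_compl) hF.countable
      fun f hf => interior_eq_empty_iff_dense_compl.1 (h f hf)).mono ?_)
    rw [← compl_iUnion₂]
    exact compl_subset_comm.1 hcov
  obtain ⟨f, hf, hfi⟩ := hex
  exact ⟨_, hcc f hf, hfi, disjoint_left.2 fun z hz => connectedComponentIn_subset _ _ hz⟩

/-- Every point is missed by a subcontinuum with interior points. Otherwise `kappa F M` is dense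
for a proper subcontinuum `M` with interior points and all finite sets `F` in the complement, so
that `F` lies in a nonblocker; by compactness some nonblocker contains all of `Mᶜ`, although
nonblockers have empty interior. -/
theorem exists_isContinuum_notMem [ConnectedSpace X] (hdec : IsDecomposable X)
    (hK : HasKelleyProperty X) (hNB : IsContinuum (nonblockers X)) (x : X) :
    ∃ W, IsContinuum W ∧ (interior W).Nonempty ∧ x ∉ W := by
  by_contra! hx
  obtain ⟨M, hM, N, hN, hMu, hNu, hMN⟩ := hdec
  have hMi := nonempty_interior_of_union_eq_univ N.isCompact.isClosed hNu hMN
  have hMc : IsContinuum (M : Set X) := ⟨M.isCompact, hM⟩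
  have hxM : x ∈ (M : Set X) := hx M hMc hMi
  obtain ⟨A, hA, hMA⟩ : (nonblockers X ∩
      ⋂ z : ((M : Set X)ᶜ : Set X), {A | ((A : Set X) ∩ {(z : X)}).Nonempty}).Nonempty := by
    refine hNB.1.inter_iInter_nonempty _ (fun z =>
      NonemptyCompacts.isClosed_inter_nonempty_of_isClosed isClosed_singleton) fun u => ?_
    rcases u.eq_empty_or_nonempty with rfl | hu
    · simpa using hNB.2.nonempty
    set F : Set X := Subtype.val '' (u : Set ((M : Set X)ᶜ : Set X)) with hFdef
    have hFfin : F.Finite := u.finite_toSet.image _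
    have hFne : F.Nonempty := (Finset.coe_nonempty.2 hu).image _
    have hMF : Disjoint (M : Set X) F := disjoint_right.2 fun z ⟨w, _, hw⟩ => hw ▸ w.2
    have hd : Dense (kappa F M) := by
      by_contra hd
      obtain ⟨W, hW, hWi, hWk⟩ :=
        exists_isContinuum_of_not_dense_kappa hK hMc hMi hFfin hFne hMF hd
      exact disjoint_left.1 hWk (hx W hW hWi) (subset_kappa hMc hMF hxM)
    obtain ⟨A, hA, hAk⟩ :=
      exists_mem_nonblockers_of_dense_kappa hK hFfin.isClosed hFne hMc hMi hMF hd
    refine ⟨A, hA, mem_iInter₂.2 fun z hz => ⟨z, ?_, rfl⟩⟩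
    rw [hAk]
    exact disjoint_right.1 (disjoint_kappa F M) ⟨z, hz, rfl⟩
  refine (nonempty_compl.2 hMu).ne_empty (subset_empty_iff.1 ?_)
  rw [← interior_eq_empty_of_mem_nonblockers hA]
  refine interior_maximal (fun z hz => ?_) M.isCompact.isClosed.isOpen_compl
  obtain ⟨y, hy, rfl⟩ := mem_iInter.1 hMA ⟨z, hz⟩
  exact hy

/-- Lower semicontinuity of `piSet` only needs that the nonblockers are compact and cover `X`. -/
theorem isOpen_piSet_inter_nonempty (hNB : IsCompact (nonblockers X))
    (hU : (⋃ A ∈ nonblockers X, (A : Set X)) = univ) {V : Set X} (hV : IsOpen V) :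
    IsOpen {x : X | (piSet x ∩ V).Nonempty} := by
  have hcl : IsClosed (⋃ A ∈ nonblockers X ∩ {A | (A : Set X) ⊆ Vᶜ}, (A : Set X)) :=
    (NonemptyCompacts.isCompact_biUnion_coe_of_isCompact (hNB.inter_right
      (NonemptyCompacts.isClosed_subsets_of_isClosed hV.isClosed_compl))).isClosed
  convert hcl.isOpen_compl using 1
  ext x
  simp only [mem_ofPred_eq, mem_compl_iff, mem_iUnion, not_exists]
  constructor
  · rintro ⟨z, hz, hzV⟩ A ⟨hA, hAV⟩ hxA
    exact hAV (piSet_subset hA hxA hz) hzV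
  · intro h
    by_contra hne
    refine h (pi x) ⟨pi_mem_nonblockers (hU ▸ mem_univ x), fun z hz hzV => hne ⟨z, hz, hzV⟩⟩
      (mem_piSet x)

/-- Upper semicontinuity of `piSet`: a point outside `piSet x` is interior to a continuum `L` that
misses `piSet x`, and `L` also misses `piSet x'` whenever `x' ∉ L`. -/
theorem isOpen_piSet_subset (hK : HasKelleyProperty X)
    (hU : (⋃ A ∈ nonblockers X, (A : Set X)) = univ)
    (hW : ∀ x : X, ∃ W, IsContinuum W ∧ (interior W).Nonempty ∧ x ∉ W) {V : Set X}
    (hV : IsOpen V) : IsOpen {x : X | piSet x ⊆ V} := by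
  have hUx : ∀ x : X, x ∈ ⋃ A ∈ nonblockers X, (A : Set X) := fun x => hU ▸ mem_univ x
  rw [isOpen_iff_mem_nhds]
  intro x hx
  obtain ⟨W, hWc, hWi, hxW⟩ := hW x
  have hWx : Disjoint W (piSet x) := (disjoint_piSet hK hWc hWi hxW (hUx x)).symm
  have hL : ∀ y ∈ Vᶜ, ∃ L, IsContinuum L ∧ W ⊆ L ∧ Disjoint L (piSet x) ∧ y ∈ interior L := by
    intro y hy
    have hyx : y ∉ piSet x := fun h => hy (hx h)
    obtain ⟨z, hz, hzW⟩ := ((mem_nonblockers.1 (pi_mem_nonblockers (hUx x))).2 y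
      hyx).inter_open_nonempty _ isOpen_interior hWi
    obtain ⟨L, hL, ⟨y', rfl, hyL⟩, hLx, hzL⟩ := mem_kappa.1 hzW
    -- The closed set `Uᶜ` shields `piSet x` from `kappa Uᶜ W`, which is open and contains `y`.
    obtain ⟨U, hUo, hUsub, hUcl⟩ := normal_exists_closure_subset (hWc.isClosed.union hL.isClosed)
      (isClosed_piSet x).isOpen_compl (disjoint_left.1 (hWx.union_left hLx))
    rw [union_subset_iff] at hUsub
    have hWU : Disjoint W Uᶜ := disjoint_compl_right_iff_subset.2 hUsub.1
    have hyk : y' ∈ kappa Uᶜ W := mem_kappa.2 ⟨L, hL, ⟨z, interior_subset hz, hzL⟩,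
      disjoint_compl_right_iff_subset.2 hUsub.2, hyL⟩
    refine ⟨closure (kappa Uᶜ W), ⟨isClosed_closure.isCompact, (isConnected_kappa hWc hWU).closure⟩,
      (subset_kappa hWc hWU).trans subset_closure, ?_, interior_maximal subset_closure
        (isOpen_kappa hK hUo.isClosed_compl hWc hWi hWU) hyk⟩
    exact disjoint_left.2 fun z hz => hUcl (closure_mono
      (disjoint_compl_right_iff_subset.1 (disjoint_kappa Uᶜ W)) hz)
  choose! L hLc hLW hLx hyL using hL
  obtain ⟨t, htV, ht⟩ := hV.isClosed_compl.isCompact.elim_nhds_subcover L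
    (fun y hy => mem_interior_iff_mem_nhds.1 (hyL y hy))
  filter_upwards [(Filter.biInter_finset_mem t).2 fun y hy =>
    (hLc y (htV y hy)).isClosed.isOpen_compl.mem_nhds
      (disjoint_right.1 (hLx y (htV y hy)) (mem_piSet x))] with x' hx' z hz
  by_contra hzV
  obtain ⟨y, hy, hzL⟩ := mem_iUnion₂.1 (ht hzV)
  exact disjoint_left.1 (disjoint_piSet hK (hLc y (htV y hy))
    (hWi.mono (interior_mono (hLW y (htV y hy)))) (mem_iInter₂.1 hx' y hy) (hUx x')) hz hzL

end Kelley

end Hyperspace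

theorem mainTheorem6 {X : Type*} [MetricSpace X] [CompactSpace X] [ConnectedSpace X]
    (hdec : Hyperspace.IsDecomposable X)
    (hKelley : Hyperspace.HasKelleyProperty X)
    (hNB : Hyperspace.IsContinuum (Hyperspace.nonblockers X)) :
    ∃ h : ∀ x : X, Hyperspace.pi x ∈ Hyperspace.subcontinua X,
      Continuous (fun x : X => (⟨Hyperspace.pi x, h x⟩ : Hyperspace.subcontinua X)) := by
  have hU := Hyperspace.biUnion_nonblockers_eq_univ hdec hKelley hNB
  have hW := Hyperspace.exists_isContinuum_notMem hdec hKelley hNB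
  refine ⟨Hyperspace.pi_mem_subcontinua, Continuous.subtype_mk ?_ _⟩
  rw [continuous_induced_rng, continuous_generateFrom_iff]
  rintro _ (⟨V, hV, rfl⟩ | ⟨V, hV, rfl⟩)
  · exact Hyperspace.isOpen_piSet_subset hKelley hU hW hV
  · exact Hyperspace.isOpen_piSet_inter_nonempty hNB.1 hU hV
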